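/- Let $d\ge 1$, let $\Omega=(-\tfrac12,\tfrac12]^d$ be the unit cell of the lattice $\mathbb Z^d$ and $\Omega^*=[-\pi,\pi]^d$ its Brillouin zone. Let $M\ge 1$ be an integer and let $V\in C^{2M-1}(\mathbb R^d)$ be a real-valued $\mathbb Z^d$-periodic potential with $V\ge 1$. For $k\in\Omega^*$ let $h(k)=(-i\nabla_p+k)^2+V$ be the Bloch fiber operator in $L^2(\Omega)$ with periodic boundary conditions, whose domain is the periodic Sobolev space $H^2(\Omega_p)$ of all $u\in L^2(\Omega)$ whose weak derivatives of order at most two, taken with periodic boundary conditions, lie in $L^2(\Omega)$. Then for every integer $0\le N\le M$ there is a constant $C_N$ (depending on $d$, $M$, $N$ and $V$ only) such that the following holds for every $k\in\Omega^*$. Let $\{u_j(\cdot,k)\}_{j\ge1}$ be any orthonormal basis of $L^2(\Omega)$ consisting of eigenfunctions of $h(k)$, $h(k)u_j(\cdot,k)=\lambda_j(k)u_j(\cdot,k)$, with $\lambda_1(k)\le\lambda_2(k)\le\cdots$, and put $$\hat\pi_{ij}(\alpha,k)=\int_\Omega u_i(x,k)\,\overline{\big[(-i\partial_\alpha+k_\alpha)u_j\big](x,k)}\,dx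 .$$ Then for all $\alpha\in\{1,\dots,d\}$ and all $s,t\ge 1$ $$|\hat\pi_{st}(\alpha,k)|=|\hat\pi_{ts}(\alpha,k)|\le C_N\,\frac{\lambda_s(k)^{N+1/2}}{\lambda_t(k)^{N}} .$$ -/

import Mathlib

open MeasureTheory
open scoped ContDiff

noncomputable section

namespace Bloch

/-- The unit cell `Ω` of the lattice `ℤ^d`: the unit cube centred at the origin. -/
def cell (d : ℕ) : Set (Fin d → ℝ) :=
  Set.univ.pi fun _ => Set.Ioc (-(1 / 2) : ℝ) (1 / 2)

/-- The Brillouin zone `Ω^* = [-π, π]^d` of the lattice `ℤ^d`. -/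
def brillouinZone (d : ℕ) : Set (Fin d → ℝ) :=
  Set.univ.pi fun _ => Set.Icc (-Real.pi) Real.pi

/-- `ℤ^d`-periodicity of a function on `ℝ^d`. -/
def IsPeriodic {d : ℕ} {E : Type*} (f : (Fin d → ℝ) → E) : Prop :=
  ∀ (m : Fin d → ℤ) (x : Fin d → ℝ), f (x + fun i => (m i : ℝ)) = f x

/-- The Hilbert space `L²(Ω)`. -/
abbrev CellL2 (d : ℕ) : Type := Lp ℂ 2 (volume.restrict (cell d))

/-- `v ∈ L²(Ω)` is the weak partial derivative, with periodic boundary conditions, of `u ∈ L²(Ω)`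
in direction `α`: integration by parts over `Ω` holds, without boundary terms, against all smooth
`ℤ^d`-periodic test functions. -/
def HasWeakPartial {d : ℕ} (α : Fin d) (u v : CellL2 d) : Prop :=
  ∀ φ : (Fin d → ℝ) → ℂ, ContDiff ℝ ∞ φ → IsPeriodic φ →
    ∫ x in cell d, u x * fderiv ℝ φ x (Pi.single α 1) = - ∫ x in cell d, v x * φ x

/-- The periodic Sobolev space `H²(Ω_p)`: all weak derivatives of order at most two, with periodic
boundary conditions, exist in `L²(Ω)`. -/
def MemH2 {d : ℕ} (u : CellL2 d) : Prop :=
  ∀ α, ∃ v, HasWeakPartial α u v ∧ ∀ β, ∃ w, HasWeakPartial β v w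

open Classical in
/-- The weak partial derivative `∂_α u` (it is unique; the value is `0` if there is none). -/
def weakPartial {d : ℕ} (α : Fin d) (u : CellL2 d) : CellL2 d :=
  if h : ∃ v, HasWeakPartial α u v then h.choose else 0

/-- The `α`-th component `-i ∂_α + k_α` of `-i∇_p + k`. -/
def momentum {d : ℕ} (k : Fin d → ℝ) (α : Fin d) (u : CellL2 d) : CellL2 d :=
  (-Complex.I) • weakPartial α u + (k α : ℂ) • u

/-- The function `h(k) u = (-i∇_p + k)² u + V u` (defined up to null sets), for `u` in the domain
`H²(Ω_p)`. -/
def fiber {d : ℕ} (V : (Fin d → ℝ) → ℝ) (k : Fin d → ℝ) (u : CellL2 d) : (Fin d → ℝ) → ℂ :=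
  fun x => (∑ α, momentum k α (momentum k α u) : CellL2 d) x + (V x : ℂ) * u x

/-- `u` belongs to the domain `H²(Ω_p)` of `h(k)` and `h(k) u = lam u` in `L²(Ω)`. -/
def IsEigen {d : ℕ} (V : (Fin d → ℝ) → ℝ) (k : Fin d → ℝ) (lam : ℝ) (u : CellL2 d) : Prop :=
  MemH2 u ∧ ∀ᵐ x ∂(volume.restrict (cell d)), fiber V k u x = (lam : ℂ) * u x

/-- An orthonormal basis of `L²(Ω)` consisting of eigenfunctions of `h(k)`, the eigenvalues being
listed (with multiplicity) in increasing order. The numbering starts at `0`. -/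
structure IsEigenbasis {d : ℕ} (V : (Fin d → ℝ) → ℝ) (k : Fin d → ℝ) (lam : ℕ → ℝ)
    (u : HilbertBasis ℕ ℂ (CellL2 d)) : Prop where
  monotone : Monotone lam
  isEigen : ∀ j, IsEigen V k (lam j) (u j)

/-- The momentum matrix element `∫_Ω u_i(x) * conj (((-i∂_α + k_α) u_j)(x)) dx`
(the inner product of Mathlib is conjugate-linear in its first argument). -/
def momentumElement {d : ℕ} (k : Fin d → ℝ) (u : HilbertBasis ℕ ℂ (CellL2 d)) (α : Fin d)
    (i j : ℕ) : ℂ :=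
  inner ℂ (momentum k α (u j)) (u i)

end Bloch

end

namespace Bloch

/-! Write `P = -i∇ + k`, so that `h(k) = P² + V`. Formally, symmetry of `h(k)` gives `λ_t^N ⟨u_t, f⟩
= ⟨u_t, h(k)^N f⟩`, which is bounded by the Sobolev norm of `f` of order `2N`. For `f = P_α u_s`
this is at most the norm of `u_s` of order `2N + 1`, and elliptic regularity bounds that by a
constant times `λ_s^(N + 1/2)`.

Everything is done on Fourier coefficients. There `P_α` is multiplication by the real number `2πn_α
+ k_α`, and Sobolev norms are weighted `ℓ²` sums with values in `[0, ∞]`, so finiteness of the norm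
replaces membership. The only analytic input about `V` is that multiplication by a periodic `C^m`
function is bounded in order `m` (`exists_sobolevSq_mulOp_le`). The commutator of `P_α` with `W` is
`-i∂_αW`, which does not involve `k`, so the bound is uniform in `k`. Two inductions use it:
`exists_sobolevSq_eigen_le` gains two orders of regularity at a time from `(1 + P²)u = (λ + 1)u -
Vu`, and `exists_enorm_pow_mul_inner_sq_le` moves one factor `λ` at a time from `u` onto `f`. -/

/-! ### Integration over the unit cell -/

theorem measurableSet_cell (d : ℕ) : MeasurableSet (cell d) :=
  MeasurableSet.univ_pi fun _ => measurableSet_Ioc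

theorem volume_cell (d : ℕ) : volume (cell d) = 1 := by
  unfold cell
  rw [Real.volume_pi_Ioc]
  norm_num

instance isFiniteMeasure_restrict_cell (d : ℕ) : IsFiniteMeasure (volume.restrict (cell d)) :=
  ⟨by simp [volume_cell]⟩

theorem cell_subset_Icc (d : ℕ) :
    cell d ⊆ Set.Icc (fun _ : Fin d => (-(1 / 2) : ℝ)) (fun _ => 1 / 2) := fun _ hx =>
  ⟨fun i => (hx i trivial).1.le, fun i => (hx i trivial).2⟩

theorem integrableOn_cell {d : ℕ} {f : (Fin d → ℝ) → ℂ} (hf : Continuous f) :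
    IntegrableOn f (cell d) :=
  (hf.continuousOn.integrableOn_compact isCompact_Icc).mono_set (cell_subset_Icc d)

/-- A continuous function is bounded on the cell. -/
theorem exists_bound_cell {d : ℕ} {W : (Fin d → ℝ) → ℂ} (hW : Continuous W) :
    ∃ C : ℝ, 0 < C ∧ ∀ x ∈ cell d, ‖W x‖ ≤ C := by
  obtain ⟨C, hC⟩ := (isCompact_Icc (a := fun _ : Fin d => (-(1 / 2) : ℝ))
    (b := fun _ => 1 / 2)).exists_bound_of_continuousOn hW.continuousOn
  exact ⟨max C 1, by positivity, fun x hx => (hC x (cell_subset_Icc d hx)).trans (le_max_left _ _)⟩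

/-- The partial derivatives of a periodic function integrate to zero over the cell. -/
theorem integral_cell_partial_eq_zero {d : ℕ} (α : Fin d) {ψ : (Fin d → ℝ) → ℂ}
    (hψ : ContDiff ℝ 1 ψ) (hper : IsPeriodic ψ) :
    ∫ x in cell d, fderiv ℝ ψ x (Pi.single α 1) = 0 := by
  obtain _ | n := d
  · exact α.elim0
  have hcont : Continuous fun x => fderiv ℝ ψ x (Pi.single α 1) :=
    (hψ.continuous_fderiv one_ne_zero).clm_apply continuous_const
  -- Divergence theorem for the vector field whose only nonzero component is `ψ`, in direction `α`.
  have key := integral_divergence_of_hasFDerivAt_off_countable'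
    (fun _ : Fin (n + 1) => (-(1 / 2) : ℝ)) (fun _ => 1 / 2) (fun _ => by norm_num)
    (fun i => if i = α then ψ else 0) (fun i => if i = α then fderiv ℝ ψ else 0) ∅
    Set.countable_empty
    (fun i => by
      split_ifs
      · exact hψ.continuous.continuousOn
      · exact continuousOn_const)
    (fun x _ i => by
      split_ifs
      · exact (hψ.differentiable one_ne_zero x).hasFDerivAt
      · exact hasFDerivAt_const 0 x)
    (by
      have : (fun x => ∑ i, (if i = α then fderiv ℝ ψ else 0) x (Pi.single i 1)) =
          fun x => fderiv ℝ ψ x (Pi.single α 1) := by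
        funext x
        rw [Finset.sum_eq_single α] <;> simp +contextual
      rw [this]
      exact hcont.continuousOn.integrableOn_compact isCompact_Icc)
  have h1 : (fun x => ∑ i, (if i = α then fderiv ℝ ψ else 0) x (Pi.single i 1)) =
      fun x => fderiv ℝ ψ x (Pi.single α 1) := by
    funext x
    rw [Finset.sum_eq_single α] <;> simp +contextual
  rw [h1] at key
  have h2 : cell (n + 1) =ᵐ[volume] Set.Icc (fun _ => (-(1 / 2) : ℝ)) (fun _ => 1 / 2) := by
    exact Measure.univ_pi_Ioc_ae_eq_Icc
  rw [setIntegral_congr_set h2, key]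
  refine Finset.sum_eq_zero fun i _ => ?_
  rw [← integral_sub']
  · refine integral_eq_zero_of_ae (Filter.Eventually.of_forall fun x => ?_)
    by_cases hi : i = α
    · subst hi
      -- A unit lattice translation carries the face at `-1/2` to the face at `1/2`, so the two
      -- boundary terms cancel.
      have := hper (Pi.single i 1) (i.insertNth (-(1 / 2) : ℝ) x)
      have e : (i.insertNth (-(1 / 2) : ℝ) x + fun j => (((Pi.single i 1 : Fin (n + 1) → ℤ) j : ℤ) : ℝ))
          = i.insertNth (1 / 2 : ℝ) x := by
        funext j
        refine i.succAboveCases ?_ (fun j => ?_) j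
        · simp; norm_num
        · simp
      rw [e] at this
      simpa [sub_eq_zero] using this
    · simp [hi]
  all_goals
    refine Continuous.integrableOn_Icc ?_
    have : Continuous (if i = α then ψ else 0) := by
      split_ifs
      exacts [hψ.continuous, continuous_const]
    exact this.comp (by fun_prop)

/-! ### The Fourier basis of the cell, transported from the torus -/

/-- The projection of `ℝ^d` onto the torus. -/
def torusMk (d : ℕ) (x : Fin d → ℝ) : UnitAddTorus (Fin d) := fun i => (x i : UnitAddCircle)

/-- The section of `torusMk` with values in the cell. -/
noncomputable def torusSection (d : ℕ) (y : UnitAddTorus (Fin d)) : Fin d → ℝ :=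
  fun i => (AddCircle.equivIoc (1 : ℝ) (-(1 / 2)) (y i) : ℝ)

/-- The normalized Haar measure of the torus. -/
noncomputable abbrev torusMeasure (d : ℕ) : Measure (UnitAddTorus (Fin d)) :=
  Measure.pi fun _ => AddCircle.haarAddCircle

theorem measurePreserving_torusMk (d : ℕ) :
    MeasurePreserving (torusMk d) (volume.restrict (cell d)) (torusMeasure d) := by
  have h := measurePreserving_pi (fun _ : Fin d => volume.restrict (Set.Ioc (-(1 / 2) : ℝ) (1 / 2)))
    (fun _ : Fin d => (AddCircle.haarAddCircle : Measure UnitAddCircle)) (f := fun _ t => (t : UnitAddCircle))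
    (fun _ => by
      have := AddCircle.measurePreserving_mk 1 (-(1 / 2) : ℝ)
      rw [AddCircle.volume_eq_smul_haarAddCircle] at this
      norm_num at this
      norm_num
      exact this)
  rw [← Measure.restrict_pi_pi] at h
  exact h

/-- The half-open cell contains exactly one point of each class, so no boundary points need to be
excluded. -/
theorem torusSection_torusMk {d : ℕ} {x : Fin d → ℝ} (hx : x ∈ cell d) :
    torusSection d (torusMk d x) = x := by
  funext i
  have hxi : x i ∈ Set.Ioc (-(1 / 2) : ℝ) (-(1 / 2) + 1) := by
    have := hx i trivial
    norm_num at this ⊢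
    exact this
  simp only [torusSection, torusMk]
  rw [AddCircle.equivIoc_coe_eq hxi]

theorem measurable_torusSection (d : ℕ) : Measurable (torusSection d) :=
  measurable_pi_iff.mpr fun i => measurable_subtype_coe.comp
    ((AddCircle.measurableEquivIoc (1 : ℝ) (-(1 / 2))).measurable.comp (measurable_pi_apply i))

/-- The torus measure is the image of the cell measure, and going to the torus and back is the
identity on the cell. -/
theorem measurePreserving_torusSection (d : ℕ) :
    MeasurePreserving (torusSection d) (torusMeasure d) (volume.restrict (cell d)) := by
  refine ⟨measurable_torusSection d, ?_⟩
  have h := measurePreserving_torusMk d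
  rw [← h.map_eq, Measure.map_map (measurable_torusSection d) h.measurable]
  conv_rhs => rw [← Measure.map_id (μ := volume.restrict (cell d))]
  refine Measure.map_congr ?_
  filter_upwards [ae_restrict_mem (measurableSet_cell d)] with x hx
  exact torusSection_torusMk hx

/-- Pulling back along `torusMk` identifies `L²` of the torus with `L²` of the cell. -/
noncomputable def torusIso (d : ℕ) : Lp ℂ 2 (torusMeasure d) ≃ₗᵢ[ℂ] CellL2 d :=
  LinearIsometryEquiv.ofSurjective
    (Lp.compMeasurePreservingₗᵢ ℂ (torusMk d) (measurePreserving_torusMk d)) fun u => by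
      refine ⟨Lp.compMeasurePreserving (torusSection d) (measurePreserving_torusSection d) u, ?_⟩
      refine Lp.ext ?_
      have h1 := Lp.coeFn_compMeasurePreserving
        (Lp.compMeasurePreserving (torusSection d) (measurePreserving_torusSection d) u)
        (measurePreserving_torusMk d)
      have h2 := (measurePreserving_torusMk d).quasiMeasurePreserving.ae_eq_comp
        (Lp.coeFn_compMeasurePreserving u (measurePreserving_torusSection d))
      filter_upwards [h1, h2, ae_restrict_mem (measurableSet_cell d)] with x hx1 hx2 hx
      refine hx1.trans (hx2.trans ?_)
      simp [torusSection_torusMk hx]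

/-- The Fourier basis of `L²(Ω)`. -/
noncomputable def fourierBasis (d : ℕ) : HilbertBasis (Fin d → ℤ) ℂ (CellL2 d) :=
  HilbertBasis.ofRepr ((torusIso d).symm.trans
    (UnitAddTorus.mFourierBasis : HilbertBasis (Fin d → ℤ) ℂ (Lp ℂ 2 (torusMeasure d))).repr)

/-- The character `x ↦ exp (2πi n·x)`. -/
noncomputable def character {d : ℕ} (n : Fin d → ℤ) (x : Fin d → ℝ) : ℂ :=
  Complex.exp (2 * Real.pi * Complex.I * ∑ i, (n i : ℂ) * (x i : ℂ))

theorem coeFn_fourierBasis {d : ℕ} (n : Fin d → ℤ) :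
    fourierBasis d n =ᵐ[volume.restrict (cell d)] character n := by
  have h0 : fourierBasis d n = torusIso d
      ((UnitAddTorus.mFourierBasis : HilbertBasis (Fin d → ℤ) ℂ (Lp ℂ 2 (torusMeasure d))) n) := by
    classical
    rw [← HilbertBasis.repr_symm_single, ← HilbertBasis.repr_symm_single]
    rfl
  rw [h0, UnitAddTorus.coe_mFourierBasis]
  have h1 := Lp.coeFn_compMeasurePreserving
    (UnitAddTorus.mFourierLp (d := Fin d) 2 n : Lp ℂ 2 (torusMeasure d)) (measurePreserving_torusMk d)
  have h2 := (measurePreserving_torusMk d).quasiMeasurePreserving.ae_eq_comp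
    (UnitAddTorus.coeFn_mFourierLp (d := Fin d) 2 n)
  refine h1.trans (h2.trans (Filter.Eventually.of_forall fun x => ?_))
  simp only [Function.comp, UnitAddTorus.mFourier, ContinuousMap.coe_mk, torusMk, character,
    fourier_coe_apply, Finset.mul_sum, Complex.exp_sum]
  refine Finset.prod_congr rfl fun i _ => ?_
  congr 1
  push_cast
  ring

theorem contDiff_character {d : ℕ} (n : Fin d → ℤ) : ContDiff ℝ ∞ (character n) := by
  unfold character
  refine ContDiff.cexp (contDiff_const.mul (ContDiff.sum fun i _ => contDiff_const.mul ?_))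
  exact Complex.ofRealCLM.contDiff.comp (contDiff_apply ℝ ℝ i)

theorem isPeriodic_character {d : ℕ} (n : Fin d → ℤ) : IsPeriodic (character n) := by
  intro m x
  unfold character
  rw [Complex.exp_eq_exp_iff_exists_int]
  refine ⟨∑ i, n i * m i, ?_⟩
  push_cast
  simp only [Pi.add_apply, Complex.ofReal_add, Complex.ofReal_intCast, mul_add,
    Finset.sum_add_distrib]
  ring

theorem fderiv_character {d : ℕ} (n : Fin d → ℤ) (x : Fin d → ℝ) (α : Fin d) :
    fderiv ℝ (character n) x (Pi.single α 1) =
      2 * Real.pi * Complex.I * n α * character n x := by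
  have h0 : ∀ i : Fin d, HasFDerivAt (fun x : Fin d → ℝ => (x i : ℂ))
      (Complex.ofRealCLM.comp (ContinuousLinearMap.proj (R := ℝ) (φ := fun _ => ℝ) i)) x := fun i =>
    (Complex.ofRealCLM.comp (ContinuousLinearMap.proj (R := ℝ) (φ := fun _ => ℝ) i)).hasFDerivAt
  have h1 := fun i : Fin d => (h0 i).const_mul (n i : ℂ)
  have h2 := ((HasFDerivAt.fun_sum (u := Finset.univ) fun i _ => h1 i).const_mul
    (2 * Real.pi * Complex.I)).cexp
  have h3 : fderiv ℝ (character n) x = _ := h2.fderiv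
  rw [h3]
  simp only [smul_apply, sum_apply,
    ContinuousLinearMap.comp_apply, ContinuousLinearMap.proj_apply, Complex.ofRealCLM_apply,
    smul_eq_mul]
  have e : ∑ i, (n i : ℂ) * (((Pi.single α 1 : Fin d → ℝ) i : ℝ) : ℂ) = n α := by
    simp [Pi.single_apply, apply_ite Complex.ofReal]
  rw [e, character]
  ring

theorem conj_character {d : ℕ} (n : Fin d → ℤ) (x : Fin d → ℝ) :
    (starRingEnd ℂ) (character n x) = character (-n) x := by
  simp only [character, ← Complex.exp_conj]
  congr 1
  simp [map_ofNat]

/-! ### Fourier coefficients and integration by parts -/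

/-- The Fourier coefficients of an element of `L²(Ω)`. -/
noncomputable def coeff {d : ℕ} (u : CellL2 d) (n : Fin d → ℤ) : ℂ := inner ℂ (fourierBasis d n) u

theorem coeff_add {d : ℕ} (u v : CellL2 d) (n : Fin d → ℤ) :
    coeff (u + v) n = coeff u n + coeff v n := inner_add_right _ _ _

theorem coeff_sub {d : ℕ} (u v : CellL2 d) (n : Fin d → ℤ) :
    coeff (u - v) n = coeff u n - coeff v n := inner_sub_right _ _ _

theorem coeff_smul {d : ℕ} (c : ℂ) (u : CellL2 d) (n : Fin d → ℤ) :
    coeff (c • u) n = c * coeff u n := inner_smul_right _ _ _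

theorem coeff_sum {d : ℕ} {ι : Type*} (s : Finset ι) (u : ι → CellL2 d) (n : Fin d → ℤ) :
    coeff (∑ i ∈ s, u i) n = ∑ i ∈ s, coeff (u i) n := inner_sum _ _ _

theorem ext_coeff {d : ℕ} {u v : CellL2 d} (h : ∀ n, coeff u n = coeff v n) : u = v := by
  apply (fourierBasis d).repr.injective
  ext n
  rw [HilbertBasis.repr_apply_apply, HilbertBasis.repr_apply_apply]
  exact h n

theorem coeff_eq_integral {d : ℕ} (u : CellL2 d) (n : Fin d → ℤ) :
    coeff u n = ∫ x in cell d, u x * character (-n) x := by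
  rw [coeff, L2.inner_def]
  refine integral_congr_ae ?_
  filter_upwards [coeFn_fourierBasis n] with x hx
  rw [hx, RCLike.inner_apply, conj_character]

theorem hasSum_coeff {d : ℕ} (u v : CellL2 d) :
    HasSum (fun n => (starRingEnd ℂ) (coeff u n) * coeff v n) (inner ℂ u v) := by
  simpa [coeff] using (fourierBasis d).hasSum_inner_mul_inner u v

/-- Characters are themselves admissible test functions. -/
theorem HasWeakPartial.coeff_eq {d : ℕ} {α : Fin d} {u v : CellL2 d} (h : HasWeakPartial α u v)
    (n : Fin d → ℤ) : coeff v n = 2 * Real.pi * Complex.I * n α * coeff u n := by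
  have := h (character (-n)) (contDiff_character _) (isPeriodic_character _)
  simp only [fderiv_character] at this
  rw [coeff_eq_integral, coeff_eq_integral, ← integral_const_mul, ← neg_inj, ← this,
    ← integral_neg]
  congr 1
  funext x
  push_cast [Pi.neg_apply]
  ring

theorem memLp_cell {d : ℕ} {φ : (Fin d → ℝ) → ℂ} (hφ : Continuous φ) :
    MemLp φ 2 (volume.restrict (cell d)) := by
  obtain ⟨C, -, hC⟩ := exists_bound_cell hφ
  refine MemLp.of_bound hφ.aestronglyMeasurable C ?_
  filter_upwards [ae_restrict_mem (measurableSet_cell d)] with x hx using hC x hx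

/-- Turns the bilinear pairing with a test function into an inner product, so that Parseval applies.
-/
theorem inner_toLp_conj {d : ℕ} {φ : (Fin d → ℝ) → ℂ} (hφ : Continuous φ) (u : CellL2 d) :
    inner ℂ ((memLp_cell (Complex.continuous_conj.comp hφ)).toLp _ : CellL2 d) u =
      ∫ x in cell d, u x * φ x := by
  rw [L2.inner_def]
  refine integral_congr_ae ?_
  filter_upwards [(memLp_cell (Complex.continuous_conj.comp hφ)).coeFn_toLp] with x hx
  rw [hx, RCLike.inner_apply]
  simp

theorem integral_partial_mul_character {d : ℕ} (α : Fin d) {φ : (Fin d → ℝ) → ℂ}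
    (hφ : ContDiff ℝ 1 φ) (hper : IsPeriodic φ) (n : Fin d → ℤ) :
    ∫ x in cell d, character n x * fderiv ℝ φ x (Pi.single α 1) =
      -(2 * Real.pi * Complex.I * n α) * ∫ x in cell d, character n x * φ x := by
  have hc : ContDiff ℝ 1 (character n) := (contDiff_character n).of_le (by simp)
  have h := integral_cell_partial_eq_zero α (hc.mul hφ) (fun m x => by
    simp only [isPeriodic_character n m x, hper m x])
  have e : ∀ x, fderiv ℝ (fun x => character n x * φ x) x (Pi.single α 1) =
      character n x * fderiv ℝ φ x (Pi.single α 1) +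
        2 * Real.pi * Complex.I * n α * (character n x * φ x) := fun x => by
    rw [fderiv_fun_mul (hc.differentiable one_ne_zero x) (hφ.differentiable one_ne_zero x)]
    simp only [add_apply, smul_apply, fderiv_character,
      smul_eq_mul]
    ring
  simp only [e] at h
  rw [integral_add, integral_const_mul] at h
  · linear_combination h
  · exact integrableOn_cell (hc.continuous.mul
      ((hφ.continuous_fderiv one_ne_zero).clm_apply continuous_const))
  · exact integrableOn_cell (continuous_const.mul (hc.continuous.mul hφ.continuous))

/-- Integration by parts against `C¹` periodic functions, from the relation between the Fourier
coefficients. -/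
theorem integral_mul_partial {d : ℕ} {α : Fin d} {u v : CellL2 d}
    (h : ∀ n, coeff v n = 2 * Real.pi * Complex.I * n α * coeff u n) {φ : (Fin d → ℝ) → ℂ}
    (hφ : ContDiff ℝ 1 φ) (hper : IsPeriodic φ) :
    ∫ x in cell d, u x * fderiv ℝ φ x (Pi.single α 1) = - ∫ x in cell d, v x * φ x := by
  have hd : Continuous fun x => fderiv ℝ φ x (Pi.single α 1) :=
    (hφ.continuous_fderiv one_ne_zero).clm_apply continuous_const
  rw [← inner_toLp_conj hd, ← inner_toLp_conj hφ.continuous]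
  -- Parseval on both sides reduces the identity to `u` a character, where classical integration by
  -- parts applies.
  rw [← (fourierBasis d).tsum_inner_mul_inner, ← (fourierBasis d).tsum_inner_mul_inner, ← tsum_neg]
  congr 1
  funext n
  rw [inner_toLp_conj hd, inner_toLp_conj hφ.continuous]
  have e1 : ∀ ψ : (Fin d → ℝ) → ℂ, ∫ x in cell d, fourierBasis d n x * ψ x =
      ∫ x in cell d, character n x * ψ x := fun ψ => by
    refine integral_congr_ae ?_
    filter_upwards [coeFn_fourierBasis n] with x hx
    rw [hx]
  rw [e1, e1, integral_partial_mul_character α hφ hper]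
  have := h n
  simp only [coeff] at this
  rw [this]
  ring

/-! ### Multiplication operators and the Leibniz rule -/

theorem memLp_mul {d : ℕ} {W : (Fin d → ℝ) → ℂ} (hW : Continuous W) (u : CellL2 d) :
    MemLp (fun x => W x * u x) 2 (volume.restrict (cell d)) := by
  obtain ⟨C, -, hC⟩ := exists_bound_cell hW
  refine MemLp.of_le_mul (c := C) (Lp.memLp u)
    (hW.aestronglyMeasurable.mul (Lp.aestronglyMeasurable u)) ?_
  filter_upwards [ae_restrict_mem (measurableSet_cell d)] with x hx
  rw [norm_mul]
  exact mul_le_mul_of_nonneg_right (hC x hx) (norm_nonneg _)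

/-- Multiplication by a continuous function on `L²(Ω)`. -/
noncomputable def mulOp {d : ℕ} {W : (Fin d → ℝ) → ℂ} (hW : Continuous W) (u : CellL2 d) :
    CellL2 d := (memLp_mul hW u).toLp _

theorem coeFn_mulOp {d : ℕ} {W : (Fin d → ℝ) → ℂ} (hW : Continuous W) (u : CellL2 d) :
    mulOp hW u =ᵐ[volume.restrict (cell d)] fun x => W x * u x := (memLp_mul hW u).coeFn_toLp

theorem norm_mulOp_le {d : ℕ} {W : (Fin d → ℝ) → ℂ} (hW : Continuous W) {C : ℝ}
    (hC : ∀ x ∈ cell d, ‖W x‖ ≤ C) (u : CellL2 d) : ‖mulOp hW u‖ ≤ C * ‖u‖ := by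
  refine Lp.norm_le_mul_norm_of_ae_le_mul ?_
  filter_upwards [coeFn_mulOp hW u, ae_restrict_mem (measurableSet_cell d)] with x hx hx'
  rw [hx, norm_mul]
  exact mul_le_mul_of_nonneg_right (hC x hx') (norm_nonneg _)

theorem integrable_mul_cell {d : ℕ} (u : CellL2 d) {φ : (Fin d → ℝ) → ℂ} (hφ : Continuous φ) :
    Integrable (fun x => u x * φ x) (volume.restrict (cell d)) := by
  have := (memLp_mul hφ u).integrable (by norm_num)
  simpa only [mul_comm] using this

/-- The Leibniz rule, on the Fourier side. -/
theorem coeff_mulOp_partial {d : ℕ} {α : Fin d} {u v : CellL2 d}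
    (h : ∀ n, coeff v n = 2 * Real.pi * Complex.I * n α * coeff u n) {W : (Fin d → ℝ) → ℂ}
    (hW : ContDiff ℝ 1 W) (hper : IsPeriodic W)
    (hW' : Continuous fun x => fderiv ℝ W x (Pi.single α 1)) (n : Fin d → ℤ) :
    coeff (mulOp hW.continuous v) n + coeff (mulOp hW' u) n =
      2 * Real.pi * Complex.I * n α * coeff (mulOp hW.continuous u) n := by
  have hc : ContDiff ℝ 1 (character (-n)) := (contDiff_character _).of_le (by simp)
  -- The test function is `W` times a character, hence only `C¹`; the smooth test functions of the
  -- weak derivative would not suffice.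
  have h1 := integral_mul_partial h (hW.mul hc) (fun m x => by
    simp only [isPeriodic_character (-n) m x, hper m x])
  have e : ∀ x, u x * fderiv ℝ (fun x => W x * character (-n) x) x (Pi.single α 1) =
      u x * (fderiv ℝ W x (Pi.single α 1) * character (-n) x) -
      2 * Real.pi * Complex.I * n α * (u x * (W x * character (-n) x)) := fun x => by
    rw [fderiv_fun_mul (hW.differentiable one_ne_zero x) (hc.differentiable one_ne_zero x)]
    simp only [add_apply, smul_apply, fderiv_character,
      smul_eq_mul]
    push_cast [Pi.neg_apply]
    ring
  have key : ∀ {X : (Fin d → ℝ) → ℂ} (hX : Continuous X) (u : CellL2 d),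
      coeff (mulOp hX u) n = ∫ x in cell d, u x * (X x * character (-n) x) := fun hX u => by
    rw [coeff_eq_integral]
    refine integral_congr_ae ?_
    filter_upwards [coeFn_mulOp hX u] with x hx
    rw [hx]; ring
  simp only [e] at h1
  rw [integral_sub, integral_const_mul] at h1
  · rw [key hW.continuous, key hW.continuous, key hW']
    linear_combination h1
  · exact integrable_mul_cell u (hW'.mul hc.continuous)
  · exact (integrable_mul_cell u (hW.continuous.mul hc.continuous)).const_mul _

/-! ### Sobolev norms adapted to the quasi-momentum -/

/-- The symbol of the component `-i∂_α + k_α`. -/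
noncomputable def symbol {d : ℕ} (k : Fin d → ℝ) (α : Fin d) (n : Fin d → ℤ) : ℝ :=
  2 * Real.pi * n α + k α

/-- The symbol of `1 + (-i∇ + k)²`. -/
noncomputable def weight {d : ℕ} (k : Fin d → ℝ) (n : Fin d → ℤ) : ℝ :=
  1 + ∑ α, symbol k α n ^ 2

theorem one_le_weight {d : ℕ} (k : Fin d → ℝ) (n : Fin d → ℤ) : 1 ≤ weight k n :=
  le_add_of_nonneg_right (Finset.sum_nonneg fun _ _ => sq_nonneg _)

/-- The square of the Sobolev norm of order `m` associated with `-i∇ + k`. -/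
noncomputable def sobolevSq {d : ℕ} (k : Fin d → ℝ) (m : ℕ) (u : CellL2 d) : ENNReal :=
  ∑' n, ENNReal.ofReal (weight k n ^ m) * ‖coeff u n‖ₑ ^ 2

theorem tsum_enorm_coeff_sq {d : ℕ} (u : CellL2 d) : ∑' n, ‖coeff u n‖ₑ ^ 2 = ‖u‖ₑ ^ 2 := by
  have h : HasSum (fun n => ‖coeff u n‖ ^ 2) (‖u‖ ^ 2) := by
    have := Complex.hasSum_re (hasSum_coeff u u)
    rw [← inner_self_eq_norm_sq (𝕜 := ℂ) u]
    refine this.congr_fun fun n => ?_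
    rw [mul_comm, Complex.mul_conj, Complex.normSq_eq_norm_sq, Complex.ofReal_re]
  have e : ∀ {F : Type} [NormedAddCommGroup F] (z : F), ‖z‖ₑ ^ 2 = ENNReal.ofReal (‖z‖ ^ 2) :=
    fun z => by rw [ENNReal.ofReal_pow (norm_nonneg _), ofReal_norm]
  simp only [e]
  rw [← ENNReal.ofReal_tsum_of_nonneg (fun _ => sq_nonneg _) h.summable, h.tsum_eq]

theorem sobolevSq_zero {d : ℕ} (k : Fin d → ℝ) (u : CellL2 d) : sobolevSq k 0 u = ‖u‖ₑ ^ 2 := by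
  simp [sobolevSq, tsum_enorm_coeff_sq]

theorem sobolevSq_mono {d : ℕ} (k : Fin d → ℝ) {l m : ℕ} (h : l ≤ m) (u : CellL2 d) :
    sobolevSq k l u ≤ sobolevSq k m u :=
  ENNReal.tsum_le_tsum fun n => mul_le_mul_left
    (ENNReal.ofReal_le_ofReal (pow_le_pow_right₀ (one_le_weight k n) h)) _

theorem enorm_add_sq_le {E : Type*} [SeminormedAddCommGroup E] (a b : E) :
    ‖a + b‖ₑ ^ 2 ≤ 2 * (‖a‖ₑ ^ 2 + ‖b‖ₑ ^ 2) := by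
  have : ‖a + b‖₊ ^ 2 ≤ 2 * (‖a‖₊ ^ 2 + ‖b‖₊ ^ 2) :=
    (pow_le_pow_left₀ (zero_le) (nnnorm_add_le a b) 2).trans add_sq_le
  simp only [enorm_eq_nnnorm]
  exact_mod_cast this

theorem sobolevSq_add_le {d : ℕ} (k : Fin d → ℝ) (m : ℕ) (u v : CellL2 d) :
    sobolevSq k m (u + v) ≤ 2 * (sobolevSq k m u + sobolevSq k m v) := by
  unfold sobolevSq
  rw [← ENNReal.tsum_add, ← ENNReal.tsum_mul_left]
  refine ENNReal.tsum_le_tsum fun n => ?_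
  rw [coeff_add, ← mul_add, mul_left_comm]
  exact mul_le_mul_right (enorm_add_sq_le _ _) _

theorem sobolevSq_smul {d : ℕ} (k : Fin d → ℝ) (m : ℕ) (c : ℂ) (u : CellL2 d) :
    sobolevSq k m (c • u) = ‖c‖ₑ ^ 2 * sobolevSq k m u := by
  unfold sobolevSq
  rw [← ENNReal.tsum_mul_left]
  refine tsum_congr fun n => ?_
  rw [coeff_smul, enorm_mul, mul_pow, mul_left_comm]

theorem enorm_ofReal_mul_sq (r : ℝ) (z : ℂ) :
    ‖(r : ℂ) * z‖ₑ ^ 2 = ENNReal.ofReal (r ^ 2) * ‖z‖ₑ ^ 2 := by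
  rw [enorm_mul, mul_pow, ← sq_abs, ENNReal.ofReal_pow (abs_nonneg r), ← ofReal_norm,
    Complex.norm_real, Real.norm_eq_abs]

/-- A square summable family is the family of Fourier coefficients of an element of `L²(Ω)`. -/
theorem exists_coeff_eq {d : ℕ} {a : (Fin d → ℤ) → ℂ} (ha : ∑' n, ‖a n‖ₑ ^ 2 ≠ ⊤) :
    ∃ u : CellL2 d, ∀ n, coeff u n = a n := by
  have hmem : Memℓp a 2 := by
    refine memℓp_gen ?_
    have := ENNReal.summable_toReal ha
    refine this.congr fun n => ?_
    simp
  refine ⟨(fourierBasis d).repr.symm ⟨a, hmem⟩, fun n => ?_⟩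
  rw [coeff, ← HilbertBasis.repr_apply_apply, LinearIsometryEquiv.apply_symm_apply]

/-- One factor of the weight is split as `1 + ∑ symbol²`; this drives the induction on the order. -/
theorem sobolevSq_succ {d : ℕ} {k : Fin d → ℝ} (m : ℕ) {u : CellL2 d} {v : Fin d → CellL2 d}
    (h : ∀ α n, coeff (v α) n = symbol k α n * coeff u n) :
    sobolevSq k (m + 1) u = sobolevSq k m u + ∑ α, sobolevSq k m (v α) := by
  unfold sobolevSq
  rw [← Summable.tsum_finsetSum (fun _ _ => ENNReal.summable), ← ENNReal.tsum_add]
  refine tsum_congr fun n => ?_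
  have hw : 0 ≤ weight k n ^ m := pow_nonneg (zero_le_one.trans (one_le_weight k n)) _
  simp only [h, enorm_ofReal_mul_sq]
  rw [← Finset.mul_sum, ← Finset.sum_mul, ← ENNReal.ofReal_sum_of_nonneg (fun _ _ => sq_nonneg _),
    ← mul_add, pow_succ, ENNReal.ofReal_mul hw, weight,
    ENNReal.ofReal_add zero_le_one (Finset.sum_nonneg fun _ _ => sq_nonneg _), ENNReal.ofReal_one]
  ring

theorem sobolevSq_le_of_symbol {d : ℕ} {k : Fin d → ℝ} (m : ℕ) {u v : CellL2 d} {α : Fin d}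
    (h : ∀ n, coeff v n = symbol k α n * coeff u n) :
    sobolevSq k m v ≤ sobolevSq k (m + 1) u := by
  refine ENNReal.tsum_le_tsum fun n => ?_
  have hw : 0 ≤ weight k n ^ m := pow_nonneg (zero_le_one.trans (one_le_weight k n)) _
  rw [h, enorm_ofReal_mul_sq, ← mul_assoc, ← ENNReal.ofReal_mul hw, pow_succ]
  refine mul_le_mul_left (ENNReal.ofReal_le_ofReal (mul_le_mul_of_nonneg_left ?_ hw)) _
  exact (Finset.single_le_sum (f := fun α => symbol k α n ^ 2) (fun _ _ => sq_nonneg _)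
    (Finset.mem_univ α)).trans (le_add_of_nonneg_left zero_le_one)

/-- Riesz–Fischer: the squared symbol is at most the weight, so the new coefficients are square
summable. -/
theorem exists_symbol {d : ℕ} {k : Fin d → ℝ} {u : CellL2 d} (hu : sobolevSq k 1 u ≠ ⊤)
    (α : Fin d) : ∃ v : CellL2 d, ∀ n, coeff v n = symbol k α n * coeff u n := by
  refine exists_coeff_eq (ne_top_of_le_ne_top hu (ENNReal.tsum_le_tsum fun n => ?_))
  rw [enorm_ofReal_mul_sq, pow_one]
  refine mul_le_mul_left (ENNReal.ofReal_le_ofReal ?_) _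
  exact (Finset.single_le_sum (f := fun α => symbol k α n ^ 2) (fun _ _ => sq_nonneg _)
    (Finset.mem_univ α)).trans (le_add_of_nonneg_left zero_le_one)

theorem exists_weight {d : ℕ} {k : Fin d → ℝ} {u : CellL2 d} (hu : sobolevSq k 2 u ≠ ⊤) :
    ∃ v : CellL2 d, ∀ n, coeff v n = weight k n * coeff u n := by
  refine exists_coeff_eq ?_
  simp only [enorm_ofReal_mul_sq]
  exact hu

theorem sobolevSq_weight {d : ℕ} {k : Fin d → ℝ} (m : ℕ) {u v : CellL2 d}
    (h : ∀ n, coeff v n = weight k n * coeff u n) :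
    sobolevSq k m v = sobolevSq k (m + 2) u := by
  refine tsum_congr fun n => ?_
  have hw : 0 ≤ weight k n ^ m := pow_nonneg (zero_le_one.trans (one_le_weight k n)) _
  rw [h, enorm_ofReal_mul_sq, ← mul_assoc, ← ENNReal.ofReal_mul hw, pow_add]

theorem IsPeriodic.fderiv_apply {d : ℕ} {W : (Fin d → ℝ) → ℂ} (h : IsPeriodic W) (e : Fin d → ℝ) :
    IsPeriodic fun x => fderiv ℝ W x e := by
  intro m x
  have : (fun y => W (y + fun i => (m i : ℝ))) = W := funext fun y => h m y
  simp only
  rw [← fderiv_comp_add_right, this]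

/-- Multiplication by a periodic `C^m` function is bounded in the Sobolev space of order `m`,
uniformly in the quasi-momentum. -/
theorem exists_sobolevSq_mulOp_le {d : ℕ} (m : ℕ) : ∀ {W : (Fin d → ℝ) → ℂ},
    ContDiff ℝ m W → IsPeriodic W → ∀ hW : Continuous W,
    ∃ C : NNReal, 0 < C ∧ ∀ (k : Fin d → ℝ) (u : CellL2 d),
      sobolevSq k m (mulOp hW u) ≤ C * sobolevSq k m u := by
  induction m with
  | zero =>
    intro W _ _ hW
    obtain ⟨C, hC0, hC⟩ := exists_bound_cell hW
    lift C to NNReal using hC0.le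
    refine ⟨C ^ 2, pow_pos (by exact_mod_cast hC0) 2, fun k u => ?_⟩
    rw [sobolevSq_zero, sobolevSq_zero, ENNReal.coe_pow, ← mul_pow]
    refine pow_le_pow_left₀ zero_le ?_ 2
    rw [enorm_eq_nnnorm, enorm_eq_nnnorm, ← ENNReal.coe_mul, ENNReal.coe_le_coe, ← NNReal.coe_le_coe]
    exact norm_mulOp_le hW hC u
  | succ m ih =>
    intro W hWm hper hW
    have hW1 : ContDiff ℝ 1 W := hWm.of_le (by simp)
    have hdm : ∀ α : Fin d, ContDiff ℝ m fun x => fderiv ℝ W x (Pi.single α 1) := fun α =>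
      (hWm.fderiv_right (by norm_cast)).clm_apply contDiff_const
    have hdc : ∀ α : Fin d, Continuous fun x => fderiv ℝ W x (Pi.single α 1) := fun α =>
      (hdm α).continuous
    obtain ⟨C, hC0, hC⟩ := ih (hWm.of_le (by norm_cast; simp)) hper hW
    choose D hD0 hD using fun α : Fin d => ih (hdm α) (hper.fderiv_apply _) (hdc α)
    -- `C` and `2 * D α` collect the terms in `u`, `2 * C` those in `P_α u`; the factors 2 come from
    -- `‖a + b‖² ≤ 2(‖a‖² + ‖b‖²)`. Positivity makes the bound trivial when the norm of `u` is
    -- infinite.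
    refine ⟨C + 2 * C + ∑ α, 2 * D α, by positivity, fun k u => ?_⟩
    by_cases htop : sobolevSq k (m + 1) u = ⊤
    · rw [htop, ENNReal.mul_top]
      · exact le_top
      · have : 0 < C + 2 * C + ∑ α, 2 * D α := by positivity
        exact_mod_cast this.ne'
    have h1 : sobolevSq k 1 u ≠ ⊤ := ne_top_of_le_ne_top htop (sobolevSq_mono k (by simp) u)
    choose v hv using fun α => exists_symbol h1 α
    -- Commutator identity `P_α(Wu) = W P_α u - i(∂_αW)u`.
    have hLeib : ∀ α n, coeff (mulOp hW (v α) + (-Complex.I) • mulOp (hdc α) u) n =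
        symbol k α n * coeff (mulOp hW u) n := by
      intro α n
      -- `i(P_α u - k_α u)` is the plain derivative `∂_α u`, to which the Leibniz rule applies.
      have hp : ∀ n, coeff (Complex.I • (v α - (k α : ℂ) • u)) n =
          2 * Real.pi * Complex.I * n α * coeff u n := fun n => by
        rw [coeff_smul, coeff_sub, coeff_smul, hv, symbol]
        push_cast
        ring
      have hL := coeff_mulOp_partial hp hW1 hper (hdc α) n
      have e : mulOp hW1.continuous (Complex.I • (v α - (k α : ℂ) • u)) =
          Complex.I • (mulOp hW (v α) - (k α : ℂ) • mulOp hW u) := by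
        refine Lp.ext ?_
        filter_upwards [coeFn_mulOp hW1.continuous (Complex.I • (v α - (k α : ℂ) • u)),
          Lp.coeFn_smul Complex.I (v α - (k α : ℂ) • u), Lp.coeFn_sub (v α) ((k α : ℂ) • u),
          Lp.coeFn_smul (k α : ℂ) u, coeFn_mulOp hW (v α), coeFn_mulOp hW u,
          Lp.coeFn_smul Complex.I (mulOp hW (v α) - (k α : ℂ) • mulOp hW u),
          Lp.coeFn_sub (mulOp hW (v α)) ((k α : ℂ) • mulOp hW u),
          Lp.coeFn_smul (k α : ℂ) (mulOp hW u)] with x h1 h2 h3 h4 h5 h6 h7 h8 h9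
        rw [h1, h2, h7, Pi.smul_apply, Pi.smul_apply, h3, h8, Pi.sub_apply, Pi.sub_apply, h4, h9,
          Pi.smul_apply, Pi.smul_apply, h5, h6]
        simp only [smul_eq_mul]
        ring
      rw [e, coeff_smul, coeff_sub, coeff_smul] at hL
      rw [coeff_add, coeff_smul, symbol]
      push_cast
      linear_combination (-Complex.I) * hL +
        (coeff (mulOp hW (v α)) n - k α * coeff (mulOp hW u) n
          - 2 * Real.pi * n α * coeff (mulOp hW u) n) * Complex.I_sq
    rw [sobolevSq_succ m hLeib, sobolevSq_succ m hv]
    have hα : ∀ α, sobolevSq k m (mulOp hW (v α) + (-Complex.I) • mulOp (hdc α) u) ≤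
        2 * C * sobolevSq k m (v α) + 2 * D α * sobolevSq k m u := fun α => by
      refine (sobolevSq_add_le k m _ _).trans ?_
      rw [sobolevSq_smul, enorm_neg, mul_add, mul_assoc, mul_assoc]
      have : ‖Complex.I‖ₑ = 1 := by simp [enorm_eq_nnnorm]
      rw [this, one_pow, one_mul]
      exact add_le_add (mul_le_mul_right (hC k _) _) (mul_le_mul_right (hD α k u) _)
    calc sobolevSq k m (mulOp hW u) +
          ∑ α, sobolevSq k m (mulOp hW (v α) + (-Complex.I) • mulOp (hdc α) u)
        ≤ C * sobolevSq k m u + ∑ α, (2 * C * sobolevSq k m (v α) + 2 * D α * sobolevSq k m u) :=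
          add_le_add (hC k u) (Finset.sum_le_sum fun α _ => hα α)
      _ = (C + ∑ α, 2 * D α) * sobolevSq k m u + 2 * C * ∑ α, sobolevSq k m (v α) := by
          rw [Finset.sum_add_distrib, ← Finset.mul_sum, ← Finset.sum_mul]
          push_cast [ENNReal.ofNNReal_finsetSum]
          ring
      _ ≤ (C + 2 * C + ∑ α, 2 * D α) * sobolevSq k m u +
            (C + 2 * C + ∑ α, 2 * D α) * ∑ α, sobolevSq k m (v α) := by
          refine add_le_add (mul_le_mul_left ?_ _) (mul_le_mul_left ?_ _)
          · exact add_le_add_left le_self_add _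
          · exact le_add_self.trans le_self_add
      _ = _ := by push_cast [ENNReal.ofNNReal_finsetSum]; ring

/-! ### The fiber operator on the Fourier side -/

theorem hasWeakPartial_iff {d : ℕ} {α : Fin d} {u v : CellL2 d} :
    HasWeakPartial α u v ↔ ∀ n, coeff v n = 2 * Real.pi * Complex.I * n α * coeff u n :=
  ⟨fun h => h.coeff_eq, fun h _ hφ hper => integral_mul_partial h (hφ.of_le (by simp)) hper⟩

theorem hasWeakPartial_weakPartial {d : ℕ} {α : Fin d} {u : CellL2 d}
    (h : ∃ v, HasWeakPartial α u v) : HasWeakPartial α u (weakPartial α u) := by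
  rw [weakPartial, dif_pos h]
  exact h.choose_spec

theorem weakPartial_eq {d : ℕ} {α : Fin d} {u v : CellL2 d} (h : HasWeakPartial α u v) :
    weakPartial α u = v :=
  ext_coeff fun n => by rw [(hasWeakPartial_weakPartial ⟨v, h⟩).coeff_eq, h.coeff_eq]

theorem coeff_momentum {d : ℕ} (k : Fin d → ℝ) {α : Fin d} {u : CellL2 d}
    (h : ∃ v, HasWeakPartial α u v) (n : Fin d → ℤ) :
    coeff (momentum k α u) n = symbol k α n * coeff u n := by
  rw [momentum, coeff_add, coeff_smul, coeff_smul, (hasWeakPartial_weakPartial h).coeff_eq, symbol]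
  push_cast
  linear_combination (-2 * Real.pi * n α * coeff u n) * Complex.I_sq

/-- Ensures that the outer `momentum` in `P_α P_α u` uses a genuine derivative rather than the
default value `0` of `weakPartial`. -/
theorem MemH2.exists_hasWeakPartial_momentum {d : ℕ} {u : CellL2 d} (h : MemH2 u) (k : Fin d → ℝ)
    (α β : Fin d) : ∃ w, HasWeakPartial β (momentum k α u) w := by
  obtain ⟨v, hv, hv'⟩ := h α
  obtain ⟨w, hw⟩ := hv' β
  obtain ⟨z, hz, -⟩ := h β
  refine ⟨(-Complex.I) • w + (k α : ℂ) • z, hasWeakPartial_iff.mpr fun n => ?_⟩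
  rw [momentum, weakPartial_eq hv, coeff_add, coeff_add, coeff_smul, coeff_smul, coeff_smul,
    coeff_smul, hw.coeff_eq, hz.coeff_eq]
  ring

/-- On the Fourier side, the eigenvalue equation expresses `1 + (-i∇ + k)²` on an eigenfunction
through multiplications. -/
theorem IsEigen.weight_mul_coeff {d : ℕ} {V : (Fin d → ℝ) → ℝ} {k : Fin d → ℝ} {lam : ℝ}
    {u : CellL2 d} (h : IsEigen V k lam u) (hV : Continuous fun x => (V x : ℂ)) (n : Fin d → ℤ) :
    coeff (((lam + 1 : ℝ) : ℂ) • u + (-1 : ℂ) • mulOp hV u) n = weight k n * coeff u n := by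
  have e : (∑ α, momentum k α (momentum k α u) : CellL2 d) + mulOp hV u = (lam : ℂ) • u := by
    refine Lp.ext ?_
    filter_upwards [h.2, coeFn_mulOp hV u, Lp.coeFn_smul (lam : ℂ) u,
      Lp.coeFn_add (∑ α, momentum k α (momentum k α u) : CellL2 d) (mulOp hV u)] with x h1 h2 h3 h4
    rw [h3, h4, Pi.add_apply, h2, Pi.smul_apply, smul_eq_mul, ← h1, fiber]
  have e' := congrArg (fun w => coeff w n) e
  simp only [coeff_add, coeff_smul, coeff_sum] at e' ⊢
  have hs : ∀ α, coeff (momentum k α (momentum k α u)) n = (symbol k α n : ℂ) ^ 2 * coeff u n :=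
    fun α => by
      obtain ⟨v, hv, -⟩ := h.1 α
      rw [coeff_momentum k (h.1.exists_hasWeakPartial_momentum k α α), coeff_momentum k ⟨v, hv⟩]
      ring
  simp only [hs, ← Finset.sum_mul] at e'
  rw [weight]
  push_cast
  linear_combination -e'

/-! ### Energy bound, elliptic regularity and decay of coefficients -/

theorem norm_sq_le_re_inner_mulOp {d : ℕ} {V : (Fin d → ℝ) → ℝ} (hV : Continuous fun x => (V x : ℂ))
    (hV1 : ∀ x, 1 ≤ V x) (u : CellL2 d) : ‖u‖ ^ 2 ≤ (inner ℂ u (mulOp hV u)).re := by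
  rw [← inner_self_eq_norm_sq (𝕜 := ℂ) u, ← RCLike.re_eq_complex_re, L2.inner_def, L2.inner_def]
  rw [← integral_re (L2.integrable_inner u u), ← integral_re (L2.integrable_inner u (mulOp hV u))]
  refine integral_mono_ae (L2.integrable_inner u u).re (L2.integrable_inner u (mulOp hV u)).re ?_
  filter_upwards [coeFn_mulOp hV u] with x hx
  simp only [hx, RCLike.inner_apply, mul_assoc, Complex.mul_conj, RCLike.re_eq_complex_re,
    ← Complex.ofReal_mul, Complex.ofReal_re]
  exact le_mul_of_one_le_left (Complex.normSq_nonneg _) (hV1 x)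

theorem inner_mulOp_left {d : ℕ} {V : (Fin d → ℝ) → ℝ} (hV : Continuous fun x => (V x : ℂ))
    (u f : CellL2 d) : inner ℂ (mulOp hV u) f = inner ℂ u (mulOp hV f) := by
  rw [L2.inner_def, L2.inner_def]
  refine integral_congr_ae ?_
  filter_upwards [coeFn_mulOp hV u, coeFn_mulOp hV f] with x hx hx'
  simp only [hx, hx', RCLike.inner_apply, map_mul, Complex.conj_ofReal]
  ring

/-- A multiplier with real symbol is symmetric. -/
theorem inner_eq_inner_of_coeff {d : ℕ} {a : (Fin d → ℤ) → ℝ} {u u' f f' : CellL2 d}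
    (hu : ∀ n, coeff u' n = a n * coeff u n) (hf : ∀ n, coeff f' n = a n * coeff f n) :
    inner ℂ u' f = inner ℂ u f' := by
  refine (hasSum_coeff u' f).unique ((hasSum_coeff u f').congr_fun fun n => ?_)
  rw [hu, hf, map_mul, Complex.conj_ofReal]
  ring

/-- The quadratic form bound for normalized eigenfunctions. -/
theorem IsEigen.sobolevSq_one_le {d : ℕ} {V : (Fin d → ℝ) → ℝ} {k : Fin d → ℝ} {lam : ℝ}
    {u : CellL2 d} (h : IsEigen V k lam u) (hV : Continuous fun x => (V x : ℂ))
    (hV1 : ∀ x, 1 ≤ V x) (hu : ‖u‖ = 1) : sobolevSq k 1 u ≤ ENNReal.ofReal lam := by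
  have hs := Complex.hasSum_re
    (hasSum_coeff u (((lam + 1 : ℝ) : ℂ) • u + (-1 : ℂ) • mulOp hV u))
  have hs' : HasSum (fun n => weight k n * ‖coeff u n‖ ^ 2)
      (inner ℂ u (((lam + 1 : ℝ) : ℂ) • u + (-1 : ℂ) • mulOp hV u)).re := by
    refine hs.congr_fun fun n => ?_
    rw [h.weight_mul_coeff hV, mul_left_comm, mul_comm _ (coeff u n), Complex.mul_conj,
      Complex.normSq_eq_norm_sq, ← Complex.ofReal_mul, Complex.ofReal_re]
  -- The form equals `λ + 1 - ⟨u, Vu⟩`, and `V ≥ 1` compensates the `1` added in the weight.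
  have hle : (inner ℂ u (((lam + 1 : ℝ) : ℂ) • u + (-1 : ℂ) • mulOp hV u)).re ≤ lam := by
    have h1 := norm_sq_le_re_inner_mulOp hV hV1 u
    rw [inner_add_right, inner_smul_right, inner_smul_right, inner_self_eq_norm_sq_to_K, hu]
    rw [hu] at h1
    simp
    linarith
  have hnn : ∀ n, 0 ≤ weight k n * ‖coeff u n‖ ^ 2 := fun n =>
    mul_nonneg (zero_le_one.trans (one_le_weight k n)) (sq_nonneg _)
  refine le_trans (le_of_eq ?_) (ENNReal.ofReal_le_ofReal hle)
  rw [← hs'.tsum_eq, ENNReal.ofReal_tsum_of_nonneg hnn hs'.summable, sobolevSq]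
  refine tsum_congr fun n => ?_
  rw [pow_one, ENNReal.ofReal_mul (zero_le_one.trans (one_le_weight k n)),
    ENNReal.ofReal_pow (norm_nonneg _), ofReal_norm]

theorem IsEigen.one_le {d : ℕ} {V : (Fin d → ℝ) → ℝ} {k : Fin d → ℝ} {lam : ℝ}
    {u : CellL2 d} (h : IsEigen V k lam u) (hV : Continuous fun x => (V x : ℂ))
    (hV1 : ∀ x, 1 ≤ V x) (hu : ‖u‖ = 1) : 1 ≤ lam := by
  have h0 := (sobolevSq_mono k zero_le_one u).trans (h.sobolevSq_one_le hV hV1 hu)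
  rw [sobolevSq_zero, ← ofReal_norm, hu, ENNReal.ofReal_one, one_pow] at h0
  exact ENNReal.one_le_ofReal.mp h0

/-- Elliptic regularity for normalized eigenfunctions: the Sobolev norm of order `m` is bounded by
the corresponding power of the eigenvalue. -/
theorem exists_sobolevSq_eigen_le {d : ℕ} {V : (Fin d → ℝ) → ℝ}
    (hV : Continuous fun x => (V x : ℂ)) (hper : IsPeriodic fun x => (V x : ℂ))
    (hV1 : ∀ x, 1 ≤ V x) {r : ℕ} (hVr : ContDiff ℝ r fun x => (V x : ℂ)) :
    ∀ m ≤ r + 2, ∃ C : NNReal, ∀ (k : Fin d → ℝ) (lam : ℝ) (u : CellL2 d), IsEigen V k lam u →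
      ‖u‖ = 1 → sobolevSq k m u ≤ C * ENNReal.ofReal lam ^ m
  | 0, _ => ⟨1, fun k lam u _ hu => by
      rw [sobolevSq_zero, ← ofReal_norm, hu]
      simp⟩
  | 1, _ => ⟨1, fun k lam u h hu => by simpa using h.sobolevSq_one_le hV hV1 hu⟩
  -- The norm of `u` of order `m + 2` is the norm of `(1 + P²)u = (λ + 1)u - Vu` of order `m`, so
  -- `V` need only be `C^m`.
  | m + 2, hm => by
      obtain ⟨C, hC⟩ := exists_sobolevSq_eigen_le hV hper hV1 hVr m (by lia)
      obtain ⟨D, -, hD⟩ := exists_sobolevSq_mulOp_le m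
        (hVr.of_le (by exact_mod_cast Nat.le_of_add_le_add_right hm)) hper hV
      -- `8 = 2 · 2²` comes from `λ + 1 ≤ 2λ`, and `2 * D` from `Vu` after inserting `1 ≤ λ²`.
      refine ⟨(8 + 2 * D) * C, fun k lam u h hu => ?_⟩
      have hlam := h.one_le hV hV1 hu
      have h1 : ‖((lam + 1 : ℝ) : ℂ)‖ₑ ≤ 2 * ENNReal.ofReal lam := by
        rw [← ofReal_norm, Complex.norm_real, Real.norm_of_nonneg (by linarith),
          ← ENNReal.ofReal_ofNat, ← ENNReal.ofReal_mul zero_le_two]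
        exact ENNReal.ofReal_le_ofReal (by linarith)
      have h2 : 1 ≤ ENNReal.ofReal lam ^ 2 := one_le_pow₀ (ENNReal.one_le_ofReal.mpr hlam)
      rw [← sobolevSq_weight m (h.weight_mul_coeff hV)]
      calc _ ≤ 2 * (‖((lam + 1 : ℝ) : ℂ)‖ₑ ^ 2 * sobolevSq k m u + sobolevSq k m (mulOp hV u)) := by
            refine (sobolevSq_add_le k m _ _).trans (le_of_eq ?_)
            rw [sobolevSq_smul, sobolevSq_smul]
            simp
        _ ≤ 2 * ((2 * ENNReal.ofReal lam) ^ 2 * sobolevSq k m u +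
              D * (ENNReal.ofReal lam ^ 2 * sobolevSq k m u)) := by
            gcongr
            exact (hD k u).trans (mul_le_mul_right (le_mul_of_one_le_left' h2) _)
        _ = (8 + 2 * D) * ENNReal.ofReal lam ^ 2 * sobolevSq k m u := by ring
        _ ≤ (8 + 2 * D) * ENNReal.ofReal lam ^ 2 * (C * ENNReal.ofReal lam ^ m) := by
            gcongr
            exact hC k lam u h hu
        _ = _ := by push_cast; ring

/-- Decay in the eigenvalue of the expansion coefficients of a Sobolev function. -/
theorem exists_enorm_pow_mul_inner_sq_le {d : ℕ} {V : (Fin d → ℝ) → ℝ}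
    (hV : Continuous fun x => (V x : ℂ)) (hper : IsPeriodic fun x => (V x : ℂ))
    {r : ℕ} (hVr : ContDiff ℝ r fun x => (V x : ℂ)) (N : ℕ) (hN : 2 * N ≤ r + 2) :
    ∃ C : NNReal, 0 < C ∧ ∀ (k : Fin d → ℝ) (lam : ℝ) (u : CellL2 d), IsEigen V k lam u →
      ‖u‖ = 1 → ∀ f : CellL2 d,
        ‖(lam : ℂ) ^ N * inner ℂ u f‖ₑ ^ 2 ≤ C * sobolevSq k (2 * N) f := by
  induction N with
  | zero =>
    refine ⟨1, one_pos, fun k lam u _ hu f => ?_⟩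
    rw [pow_zero, one_mul, mul_zero, sobolevSq_zero, ENNReal.coe_one, one_mul, ← ofReal_norm,
      ← ofReal_norm]
    refine pow_le_pow_left₀ zero_le (ENNReal.ofReal_le_ofReal ?_) 2
    simpa [hu] using norm_inner_le_norm (𝕜 := ℂ) u f
  | succ N ih =>
    obtain ⟨C, hC0, hC⟩ := ih (by lia)
    obtain ⟨D, -, hD⟩ := exists_sobolevSq_mulOp_le (2 * N)
      (hVr.of_le (by exact_mod_cast (by lia : 2 * N ≤ r))) hper hV
    -- `6 + 4D = 2(1 + 2(D + 1))`, from splitting `g + (Vf - f)` twice.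
    refine ⟨C * (6 + 4 * D), by positivity, fun k lam u h hu f => ?_⟩
    rw [show 2 * (N + 1) = 2 * N + 2 from rfl]
    by_cases htop : sobolevSq k (2 * N + 2) f = ⊤
    · rw [htop, ENNReal.mul_top]
      · exact le_top
      · have : 0 < C * (6 + 4 * D) := by positivity
        exact_mod_cast this.ne'
    obtain ⟨g, hg⟩ := exists_weight (ne_top_of_le_ne_top htop (sobolevSq_mono k (by simp) f))
    -- With `g = (1 + P²)f`, symmetry moves `h(k)` from `u` to `f`; the induction hypothesis is then
    -- applied to `g + Vf - f`, two orders less regular than `f`.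
    have e : (lam : ℂ) * inner ℂ u f = inner ℂ u (g + (mulOp hV f + (-1 : ℂ) • f)) := by
      have := inner_eq_inner_of_coeff (h.weight_mul_coeff hV) hg
      rw [inner_add_left, inner_smul_left, inner_smul_left, inner_mulOp_left, Complex.conj_ofReal,
        map_neg, map_one] at this
      rw [inner_add_right, inner_add_right, inner_smul_right, ← this]
      push_cast
      ring
    have hf := sobolevSq_mono k (Nat.le_add_right (2 * N) 2) f
    rw [pow_succ (lam : ℂ), mul_assoc, e]
    calc _ ≤ C * sobolevSq k (2 * N) (g + (mulOp hV f + (-1 : ℂ) • f)) := hC k lam u h hu _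
      _ ≤ C * (2 * (sobolevSq k (2 * N) g +
            2 * (sobolevSq k (2 * N) (mulOp hV f) + sobolevSq k (2 * N) f))) := by
          gcongr
          refine (sobolevSq_add_le k _ _ _).trans ?_
          gcongr
          refine (sobolevSq_add_le k _ _ _).trans (le_of_eq ?_)
          rw [sobolevSq_smul]
          simp
      _ ≤ C * (2 * (sobolevSq k (2 * N + 2) f +
            2 * (D * sobolevSq k (2 * N + 2) f + sobolevSq k (2 * N + 2) f))) := by
          rw [sobolevSq_weight (2 * N) hg]
          gcongr
          exact (hD k f).trans (mul_le_mul_right hf _)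
      _ = _ := by push_cast; ring

end Bloch

/-! ### The momentum matrix elements -/

theorem theorem1 {d : ℕ} (M : ℕ) (hM : 1 ≤ M) (V : (Fin d → ℝ) → ℝ)
    (hVsmooth : ContDiff ℝ ((2 * M - 1 : ℕ) : WithTop ℕ∞) V)
    (hVper : Bloch.IsPeriodic V) (hV : ∀ x, 1 ≤ V x) :
    ∀ N : ℕ, N ≤ M → ∃ C : ℝ, ∀ k ∈ Bloch.brillouinZone d,
      ∀ (lam : ℕ → ℝ) (u : HilbertBasis ℕ ℂ (Bloch.CellL2 d)), Bloch.IsEigenbasis V k lam u →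
        ∀ (α : Fin d) (s t : ℕ),
          ‖Bloch.momentumElement k u α s t‖ = ‖Bloch.momentumElement k u α t s‖ ∧
          ‖Bloch.momentumElement k u α t s‖ ≤ C * (lam s ^ ((N : ℝ) + 1 / 2) / lam t ^ N) := by
  intro N hN
  have hVr : ContDiff ℝ ((2 * M - 1 : ℕ) : WithTop ℕ∞) fun x => (V x : ℂ) :=
    Complex.ofRealCLM.contDiff.comp hVsmooth
  have hVc : Continuous fun x => (V x : ℂ) := hVr.continuous
  have hper : Bloch.IsPeriodic fun x => (V x : ℂ) := fun m x => by simp only [hVper m x]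
  obtain ⟨A, -, hA⟩ := Bloch.exists_enorm_pow_mul_inner_sq_le hVc hper hVr N (by lia)
  -- Order `2N` for the decay in `λ_t` plus one for the momentum. For `N = M` this is `(2M - 1) +
  -- 2`, the highest order that `V ∈ C^(2M-1)` allows.
  obtain ⟨B, hB⟩ := Bloch.exists_sobolevSq_eigen_le hVc hper hV hVr (2 * N + 1) (by lia)
  refine ⟨Real.sqrt (A * B), fun k _ lam u hu α s t => ?_⟩
  have hone : ∀ j, ‖u j‖ = 1 := u.orthonormal.1
  have hlam : ∀ j, 1 ≤ lam j := fun j => (hu.isEigen j).one_le hVc hV (hone j)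
  have hmom : ∀ j n, Bloch.coeff (Bloch.momentum k α (u j)) n =
      Bloch.symbol k α n * Bloch.coeff (u j) n := fun j =>
    Bloch.coeff_momentum k (((hu.isEigen j).1 α).imp fun _ h => h.1)
  refine ⟨?_, ?_⟩
  -- The symbol of `P_α` is real, so `P_α` is symmetric.
  · rw [Bloch.momentumElement, Bloch.momentumElement, norm_inner_symm,
      Bloch.inner_eq_inner_of_coeff (hmom s) (hmom t)]
  -- The decay estimate for `u_t` with `f = P_α u_s`, followed by elliptic regularity of `u_s`.
  have hkey : ‖(lam t : ℂ) ^ N * inner ℂ (u t) (Bloch.momentum k α (u s))‖ₑ ^ 2 ≤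
      A * (B * ENNReal.ofReal (lam s) ^ (2 * N + 1)) :=
    (hA k _ _ (hu.isEigen t) (hone t) _).trans (mul_le_mul_right
      ((Bloch.sobolevSq_le_of_symbol _ (hmom s)).trans (hB k _ _ (hu.isEigen s) (hone s))) _)
  have hs : 0 < lam s := one_pos.trans_le (hlam s)
  have ht : 0 < lam t ^ N := pow_pos (one_pos.trans_le (hlam t)) N
  have hreal : (lam t ^ N * ‖Bloch.momentumElement k u α t s‖) ^ 2 ≤
      A * B * lam s ^ (2 * N + 1) := by
    rw [← ofReal_norm, ← ENNReal.ofReal_pow (norm_nonneg _), ← ENNReal.ofReal_pow hs.le,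
      ← ENNReal.ofReal_coe_nnreal, ← ENNReal.ofReal_coe_nnreal,
      ← ENNReal.ofReal_mul B.coe_nonneg, ← ENNReal.ofReal_mul A.coe_nonneg,
      ENNReal.ofReal_le_ofReal_iff (by positivity), norm_mul, norm_pow, Complex.norm_real,
      Real.norm_of_nonneg (one_pos.trans_le (hlam t)).le, norm_inner_symm, ← mul_assoc] at hkey
    exact hkey
  have hpow : (lam s ^ ((N : ℝ) + 1 / 2)) ^ 2 = lam s ^ (2 * N + 1) := by
    rw [← Real.rpow_natCast, ← Real.rpow_mul hs.le, ← Real.rpow_natCast]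
    congr 1
    push_cast
    ring
  rw [mul_div_assoc', le_div_iff₀ ht, mul_comm]
  refine (Real.le_sqrt (by positivity) (by positivity)).mpr hreal |>.trans (le_of_eq ?_)
  rw [← hpow, Real.sqrt_mul (by positivity), Real.sqrt_sq (by positivity)]
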